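/- **Corollary 1.3 (Total positivity of multivariate Lah polynomials).** An *ordered tree* is a rooted tree in which the children of each vertex are linearly ordered; it is *increasing* if its vertices carry distinct integer labels and the label of each child is greater than the label of its parent. For a sequence $\boldsymbol\phi=(\phi_i)_{i\ge 0}$ in a commutative ring $R$ and $n,k\ge 0$, let $L_{n,k}(\boldsymbol\phi)\in R$ be the sum, over all unordered forests of increasing ordered trees on the vertex set $\{1,\dots,n\}$ with exactly $k$ trees, of the product over all vertices $v$ of $\phi_{i(v)}$, where $i(v)$ is the number of children of $v$. (Thus $L_{0,k}(\boldsymbol\phi)=\delta_{k0}$.) Put $L_n(\boldsymbol\phi,y)=\sum_{k=0}^n L_{n,k}(\boldsymbol\phi)\,y^k\in R[y]$. Call an infinite matrix of polynomials with integer coefficients *coefficientwise totally positive* if all its finite minors are polynomials with nonnegative coefficients, and call a sequence $(a_n)_{n\ge0}$ of such polynomials *coefficientwise Hankel-totally positive* if the matrix $(a_{i+j})_{i,j\ge0}$ is coefficientwise totally positive. Let $r\ge 1$ be an integer, and let $\boldsymbol\phi$ be either the sequence $(e_n(x_1,\dots,x_r))_{n\ge0}$ of elementary symmetric polynomials or the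 sequence $(h_n(x_1,\dots,x_r))_{n\ge0}$ of complete homogeneous symmetric polynomials in $\mathbb Z[x_1,\dots,x_r]$. Then: (a) The matrix $(L_{n,k}(\boldsymbol\phi))_{n,k\ge0}$ is lower-triangular with unit diagonal, and it is coefficientwise totally positive in $\mathbb Z[x_1,\dots,x_r]$. (b) The sequence $(L_n(\boldsymbol\phi,y))_{n\ge0}$ is coefficientwise Hankel-totally positive in $\mathbb Z[x_1,\dots,x_r,y]$. (c) The sequence $(L_{n+1,1}(\boldsymbol\phi))_{n\ge0}$ is coefficientwise Hankel-totally positive in $\mathbb Z[x_1,\dots,x_r]$. -/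

import Mathlib

noncomputable section

/-- The data of an ordered list of children (without repetition) for every vertex of the vertex
set `{0, …, n - 1}` is an *unordered forest of increasing ordered trees* if the label of each child
is greater than the label of its parent and every vertex is a child of at most one vertex.
(There are no cycles, since labels increase from parent to child. The children of each vertex
are linearly ordered, and the trees of the forest are not.) -/
def IsIncreasingOrderedForest {n : ℕ} (c : Fin n → {l : List (Fin n) // l.Nodup}) : Prop :=
  (∀ v, ∀ w ∈ (c v).1, v < w) ∧ ∀ u v w, w ∈ (c u).1 → w ∈ (c v).1 → u = v

instance {n : ℕ} :
    DecidablePred (IsIncreasingOrderedForest (n := n)) := fun c =>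
  inferInstanceAs (Decidable ((∀ v, ∀ w ∈ (c v).1, v < w) ∧
    ∀ u v w, w ∈ (c u).1 → w ∈ (c v).1 → u = v))

/-- The roots: the vertices that are nobody's child. Every tree of a forest has exactly
one root, so the number of components is the number of roots. -/
def forestRoots {n : ℕ} (c : Fin n → {l : List (Fin n) // l.Nodup}) : Finset (Fin n) :=
  Finset.univ.filter fun w => ∀ v, w ∉ (c v).1

/-- Unordered forests of increasing ordered trees on `n` vertices with `k` components. -/
def increasingOrderedForests (n k : ℕ) : Finset (Fin n → {l : List (Fin n) // l.Nodup}) :=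
  Finset.univ.filter fun c => IsIncreasingOrderedForest c ∧ (forestRoots c).card = k

/-- The generic Lah polynomial `L_{n,k}(φ)`, evaluated at a sequence `φ` in a commutative ring:
the generating polynomial of unordered forests of increasing ordered trees on `n` vertices
with `k` components, in which each vertex with `i` children gets a weight `φ i`. -/
def lah {R : Type*} [CommRing R] (φ : ℕ → R) (n k : ℕ) : R :=
  ∑ c ∈ increasingOrderedForests n k, ∏ v, φ (c v).1.length

/-- The Lah triangle `(L_{n,k}(φ))_{n,k ≥ 0}`. -/
def lahTriangle {R : Type*} [CommRing R] (φ : ℕ → R) : Matrix ℕ ℕ R :=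
  Matrix.of fun n k => lah φ n k

/-- The row-generating polynomial `L_n(φ, y) = ∑_{k = 0}^n L_{n,k}(φ) y^k` in `R[y]`. -/
def lahRow {R : Type*} [CommRing R] (φ : ℕ → R) (n : ℕ) : Polynomial R :=
  ∑ k ∈ Finset.range (n + 1), Polynomial.C (lah φ n k) * Polynomial.X ^ k

/-- Total positivity of an infinite matrix over a commutative ring `R` whose set of nonnegative
elements is `P`: all (finite) minors are nonnegative. -/
def IsTotallyPositive {R : Type*} [CommRing R] (P : Set R) (A : Matrix ℕ ℕ R) : Prop :=
  ∀ (m : ℕ) (ρ κ : Fin m → ℕ), StrictMono ρ → StrictMono κ → (A.submatrix ρ κ).det ∈ P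

/-- The infinite Hankel matrix `(a_{i+j})_{i,j ≥ 0}`. -/
def hankelMatrix {R : Type*} (a : ℕ → R) : Matrix ℕ ℕ R :=
  Matrix.of fun i j => a (i + j)

/-- Hankel-total positivity of a sequence. -/
def IsHankelTotallyPositive {R : Type*} [CommRing R] (P : Set R) (a : ℕ → R) : Prop :=
  IsTotallyPositive P (hankelMatrix a)

/-- The polynomials in `ℤ[x_1, …, x_r]` with nonnegative coefficients. -/
def coeffNonneg (r : ℕ) : Set (MvPolynomial (Fin r) ℤ) :=
  {p | ∀ d, 0 ≤ p.coeff d}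

/-- The polynomials in `ℤ[x_1, …, x_r, y] = ℤ[x_1, …, x_r][y]` with nonnegative coefficients. -/
def coeffNonnegY (r : ℕ) : Set (Polynomial (MvPolynomial (Fin r) ℤ)) :=
  {p | ∀ k d, 0 ≤ (p.coeff k).coeff d}

/-- The sequence `(e_n(x_1, …, x_r))_{n ≥ 0}` of elementary symmetric polynomials. -/
def eSeq (r : ℕ) : ℕ → MvPolynomial (Fin r) ℤ :=
  fun n => MvPolynomial.esymm (Fin r) ℤ n

/-- The sequence `(h_n(x_1, …, x_r))_{n ≥ 0}` of complete homogeneous symmetric polynomials. -/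
def hSeq (r : ℕ) : ℕ → MvPolynomial (Fin r) ℤ :=
  fun n => MvPolynomial.hsymm (Fin r) ℤ n

end

/-! Everything reduces to total positivity of one production matrix `P = lahProduction φ`, with
entries `i!/(k-1)! * φ (i+1-k)` for `1 ≤ k ≤ i+1`. Removing the least vertex of a forest turns its
ordered children into roots; hence `L_{n+1}(y) = y ∑ m! φ_m D_m L_n(y)` with Hasse derivatives `D_m`
(`lahRow_succ`), and `P` generates the Lah triangle row by row (`lah_succ_left`). Apart from a zero
column, `P` is the Toeplitz matrix of `φ` conjugated by factorials. That Toeplitz matrix is totally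
positive because the generating series of `φ` is a product of factors `1 + x_i t` or `1/(1 - x_i
t)`, and Cauchy–Binet preserves total positivity under products (`isTP_lahProduction`). A totally
positive production matrix has a totally positive output matrix (`IsTP.outputMatrix`), which gives
(a), and the zeroth column of the output is Hankel-totally positive
(`IsTP.hankelMatrix_outputMatrix`). For (b) this is applied to the matrix of all `D_k L_n(y)`, whose
production matrix is `P` times a bidiagonal matrix; for (c), to `P` without its zeroth row and
column. -/

/-! ### Determinant expansions and the Cauchy–Binet formula. -/

theorem Matrix.det_eq_mul_of_row_zero {R : Type*} [CommRing R] {m : ℕ}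
    {A : Matrix (Fin (m + 1)) (Fin (m + 1)) R} (h : ∀ j, j ≠ 0 → A 0 j = 0) :
    A.det = A 0 0 * (A.submatrix Fin.succ Fin.succ).det := by
  rw [Matrix.det_succ_row_zero, Finset.sum_eq_single 0]
  · simp only [Fin.val_zero, pow_zero, one_mul, Fin.succAbove_zero]
  · intro j _ hj
    rw [h j hj, mul_zero, zero_mul]
  · simp

theorem Matrix.det_eq_mul_of_column_zero {R : Type*} [CommRing R] {m : ℕ}
    {A : Matrix (Fin (m + 1)) (Fin (m + 1)) R} (h : ∀ i, i ≠ 0 → A i 0 = 0) :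
    A.det = A 0 0 * (A.submatrix Fin.succ Fin.succ).det := by
  rw [← Matrix.det_transpose, Matrix.det_eq_mul_of_row_zero (A := A.transpose) h,
    ← Matrix.transpose_submatrix, Matrix.det_transpose, Matrix.transpose_apply]

open Finset in
/-- The **Cauchy–Binet formula**. -/
theorem Matrix.det_mul_eq_sum_strictMono {R : Type*} [CommRing R] {β : Type*} [Fintype β]
    [LinearOrder β] {m : ℕ} (A : Matrix (Fin m) β R) (B : Matrix β (Fin m) R) :
    (A * B).det = ∑ g : Fin m → β with StrictMono g,
      (A.submatrix id g).det * (B.submatrix g id).det := by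
  have h1 : (A * B).det = ∑ f : Fin m → β, (∏ i, A i (f i)) * (B.submatrix f id).det := by
    have : A * B = fun i => ∑ k, A i k • B k := by
      ext i j
      simp [Matrix.mul_apply]
    rw [this]
    change Matrix.detRowAlternating.toMultilinearMap _ = _
    rw [MultilinearMap.map_sum]
    refine sum_congr rfl fun f _ => ?_
    rw [MultilinearMap.map_smul_univ]
    rfl
  -- A non-injective `f` selects the same row of `B` twice.
  have h2 : ∑ f : Fin m → β, (∏ i, A i (f i)) * (B.submatrix f id).det =
      ∑ f : Fin m → β with f.Injective, (∏ i, A i (f i)) * (B.submatrix f id).det := by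
    refine (sum_filter_of_ne fun f _ hf => ?_).symm
    by_contra hinj
    simp only [Function.Injective, not_forall] at hinj
    obtain ⟨a, b, hab, hne⟩ := hinj
    refine hf ?_
    rw [Matrix.det_zero_of_row_eq (M := B.submatrix f id) hne (by ext j; simp [hab]), mul_zero]
  rw [h1, h2]
  symm
  calc ∑ g : Fin m → β with StrictMono g, (A.submatrix id g).det * (B.submatrix g id).det
      = ∑ g : Fin m → β with StrictMono g, ∑ σ : Equiv.Perm (Fin m),
          (∏ i, A i (g (σ i))) * (B.submatrix (g ∘ σ) id).det := by
        refine sum_congr rfl fun g _ => ?_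
        rw [← Matrix.det_transpose, Matrix.det_apply', sum_mul]
        refine sum_congr rfl fun σ _ => ?_
        have : B.submatrix (g ∘ σ) id = (B.submatrix g id).submatrix σ id := by ext; rfl
        rw [this, Matrix.det_permute]
        simp only [Matrix.transpose_apply, Matrix.submatrix_apply, id]
        ring
    -- Sorting writes each injective `f` uniquely as `g ∘ σ` with `g` strictly increasing.
    _ = ∑ f : Fin m → β with f.Injective, (∏ i, A i (f i)) * (B.submatrix f id).det := by
        rw [← sum_product']
        refine sum_bij (fun x _ => x.1 ∘ x.2) ?_ ?_ ?_ ?_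
        · rintro ⟨g, σ⟩ h
          simp only [mem_product, mem_filter, mem_univ, true_and, and_true] at h ⊢
          exact h.injective.comp σ.injective
        · rintro ⟨g, σ⟩ h ⟨g', σ'⟩ h' heq
          simp only [mem_product, mem_filter, mem_univ, true_and, and_true] at h h' heq
          have hg : g = g' := by
            rw [← h.range_inj h', ← σ.surjective.range_comp g, heq, σ'.surjective.range_comp]
          subst hg
          have : σ = σ' := Equiv.ext fun i => h.injective (congrFun heq i)
          rw [this]
        · intro f hf
          simp only [mem_filter, mem_univ, true_and] at hf
          refine ⟨(f ∘ Tuple.sort f, (Tuple.sort f)⁻¹), ?_, ?_⟩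
          · simp only [mem_product, mem_filter, mem_univ, true_and, and_true]
            exact (Tuple.monotone_sort f).strictMono_of_injective
              (hf.comp (Tuple.sort f).injective)
          · ext i
            simp
        · intros
          rfl

/-! ### Totally positive matrices and their closure properties. -/

/-- The matrix obtained by prepending the first unit vector as a row. -/
def Matrix.consSingle {R : Type*} [CommRing R] {a b : ℕ} (A : Matrix (Fin a) (Fin (b + 1)) R) :
    Matrix (Fin (a + 1)) (Fin (b + 1)) R :=
  Matrix.of fun i j => Fin.cases (Pi.single (M := fun _ => R) 0 1 j) (A · j) i

@[simp]
theorem Matrix.consSingle_zero {R : Type*} [CommRing R] {a b : ℕ}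
    (A : Matrix (Fin a) (Fin (b + 1)) R) (j : Fin (b + 1)) :
    A.consSingle 0 j = Pi.single (M := fun _ => R) 0 1 j := rfl

@[simp]
theorem Matrix.consSingle_succ {R : Type*} [CommRing R] {a b : ℕ}
    (A : Matrix (Fin a) (Fin (b + 1)) R) (i : Fin a) (j : Fin (b + 1)) :
    A.consSingle i.succ j = A i j := rfl

/-- A matrix with linearly ordered index sets is totally positive with respect to a subsemiring
of nonnegative elements if all its minors are nonnegative. -/
def IsTP {R : Type*} [CommRing R] (S : Subsemiring R) {α β : Type*} [Preorder α] [Preorder β]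
    (A : Matrix α β R) : Prop :=
  ∀ (m : ℕ) (ρ : Fin m → α) (κ : Fin m → β), StrictMono ρ → StrictMono κ →
    (A.submatrix ρ κ).det ∈ S

namespace IsTP

variable {R : Type*} [CommRing R] {S : Subsemiring R}

theorem submatrix {α β γ δ : Type*} [Preorder α] [Preorder β] [Preorder γ] [Preorder δ]
    {A : Matrix α β R} (hA : IsTP S A) {f : γ → α} {g : δ → β} (hf : StrictMono f)
    (hg : StrictMono g) : IsTP S (A.submatrix f g) := fun m ρ κ hρ hκ =>
  hA m (f ∘ ρ) (g ∘ κ) (hf.comp hρ) (hg.comp hκ)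

theorem transpose {α β : Type*} [Preorder α] [Preorder β] {A : Matrix α β R} (hA : IsTP S A) :
    IsTP S A.transpose := fun m ρ κ hρ hκ => by
  rw [← Matrix.transpose_submatrix, Matrix.det_transpose]
  exact hA m κ ρ hκ hρ

theorem mul {α β γ : Type*} [Preorder α] [Fintype β] [LinearOrder β] [Preorder γ]
    {A : Matrix α β R} {B : Matrix β γ R} (hA : IsTP S A) (hB : IsTP S B) : IsTP S (A * B) := by
  intro m ρ κ hρ hκ
  rw [← Matrix.submatrix_mul_equiv A B ρ (Equiv.refl β) κ, Matrix.det_mul_eq_sum_strictMono]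
  refine sum_mem fun g hg => mul_mem ?_ ?_
  · exact hA m ρ g hρ (by simpa using hg)
  · exact hB m g κ (by simpa using hg) hκ

theorem map {R' : Type*} [CommRing R'] {S' : Subsemiring R'} {α β : Type*} [Preorder α]
    [Preorder β] {A : Matrix α β R} (hA : IsTP S A) (f : R →+* R') (hf : ∀ x ∈ S, f x ∈ S') :
    IsTP S' (A.map f) := fun m ρ κ hρ hκ => by
  have := hf _ (hA m ρ κ hρ hκ)
  rwa [RingHom.map_det] at this

/-- The product of two infinite totally positive matrices, the first of which is
lower-Hessenberg, is totally positive. -/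
theorem mul_nat {A B C : Matrix ℕ ℕ R} (hA : IsTP S A) (hB : IsTP S B)
    (hC : ∀ i k N, i + 1 < N → C i k = ∑ j ∈ Finset.range N, A i j * B j k) : IsTP S C := by
  intro m ρ κ hρ hκ
  -- One truncation `N` that works for all chosen rows, so that the finite product applies.
  obtain ⟨N, hN⟩ : ∃ N, ∀ i, ρ i + 1 < N :=
    ⟨∑ i, ρ i + 2, fun i => by
      have := Finset.single_le_sum (f := ρ) (fun _ _ => Nat.zero_le _) (Finset.mem_univ i)
      omega⟩
  have h := (hA.submatrix strictMono_id Fin.val_strictMono (δ := Fin N)).mul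
    (hB.submatrix Fin.val_strictMono (γ := Fin N) strictMono_id) m ρ κ hρ hκ
  convert h using 2
  ext i j
  simp [Matrix.mul_apply, hC _ _ N (hN i), Finset.sum_range]

/-- In a minor that uses the new row, only the first entry of that row can be nonzero, and it is 0
or 1; expanding along it leaves a minor of `A`. -/
theorem cons_single {a b : ℕ} {A : Matrix (Fin a) (Fin (b + 1)) R} (hA : IsTP S A) :
    IsTP S A.consSingle := by
  have key : ∀ (m : ℕ) (ρ : Fin m → Fin (a + 1)) (κ : Fin m → Fin (b + 1)), StrictMono ρ →
      StrictMono κ → (∀ i, ρ i ≠ 0) →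
      (A.consSingle.submatrix ρ κ).det ∈ S := by
    intro m ρ κ hρ hκ h0
    convert hA m (fun i => (ρ i).pred (h0 i)) κ (fun i j hij => by simpa using hρ hij) hκ using 2
    ext i j
    obtain ⟨x, hx⟩ := Fin.exists_succ_eq.2 (h0 i)
    simp [← hx]
  intro m ρ κ hρ hκ
  rcases m with _ | m
  · simp
  by_cases h0 : ρ 0 = 0
  · rw [Matrix.det_eq_mul_of_row_zero]
    · have : A.consSingle (ρ 0) (κ 0) ∈ S := by
        rw [h0]
        simp only [Matrix.consSingle_zero, Pi.single_apply]
        split_ifs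
        exacts [one_mem _, zero_mem _]
      simp only [Matrix.submatrix_apply, Matrix.submatrix_submatrix]
      refine mul_mem this (key m _ _ (hρ.comp (Fin.strictMono_succ))
        (hκ.comp (Fin.strictMono_succ)) fun i hi => ?_)
      have := hρ (Fin.succ_pos i)
      rw [h0, show ρ i.succ = 0 from hi] at this
      exact lt_irrefl _ this
    · intro j hj
      have : κ j ≠ 0 := by
        have := hκ (Fin.pos_of_ne_zero hj)
        intro h
        rw [h] at this
        simp at this
      simp [h0, this]
  · refine key _ _ _ hρ hκ fun i hi => h0 ?_
    have := hρ.monotone (Fin.zero_le i)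
    rw [hi] at this
    simpa using this

/-- Prepending a zero column. -/
theorem cons_zero_column {a b : ℕ} {A : Matrix (Fin a) (Fin b) R} (hA : IsTP S A) :
    IsTP S (Matrix.of fun i j => Fin.cases 0 (A i) j : Matrix (Fin a) (Fin (b + 1)) R) := by
  intro m ρ κ hρ hκ
  by_cases h0 : ∃ j, κ j = 0
  · obtain ⟨j, hj⟩ := h0
    rw [Matrix.det_eq_zero_of_column_eq_zero j]
    · exact zero_mem _
    · simp [hj]
  · push Not at h0
    convert hA m ρ (fun i => (κ i).pred (h0 i)) hρ (fun i j hij => by simpa using hκ hij) using 2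
    ext i j
    obtain ⟨x, hx⟩ := Fin.exists_succ_eq.2 (h0 j)
    simp [← hx]

/-- The first rows of the powers of a totally positive matrix. -/
theorem pow_row_fin {N : ℕ} {Q : Matrix (Fin (N + 1)) (Fin (N + 1)) R} (hQ : IsTP S Q) (b : ℕ) :
    IsTP S (Matrix.of fun n k => (Q ^ (n : ℕ)) 0 k : Matrix (Fin b) (Fin (N + 1)) R) := by
  induction b with
  | zero =>
    intro m ρ κ _ _
    rcases m with _ | m
    · simp
    · exact (ρ 0).elim0
  | succ b ih =>
    -- With `M` the matrix for `b` and `e₀` the first unit row, the matrix for `b + 1` is the block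
    -- product of `diag(1, M)` and the matrix `Q` with `e₀` placed on top.
    convert ih.cons_zero_column.cons_single.mul hQ.cons_single using 1
    ext i k
    refine Fin.cases ?_ (fun i => ?_) i
    · simp [Matrix.mul_apply, Matrix.one_apply, Pi.single_apply, @eq_comm _ 0 k]
    · simp [Matrix.mul_apply, Fin.sum_univ_succ (n := N + 1), pow_succ]

theorem pow_row {N : ℕ} {Q : Matrix (Fin (N + 1)) (Fin (N + 1)) R} (hQ : IsTP S Q) :
    IsTP S (Matrix.of fun n k => (Q ^ n) 0 k : Matrix ℕ (Fin (N + 1)) R) := by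
  intro m ρ κ hρ hκ
  have h : ∀ i, ρ i < ∑ i, ρ i + 1 := fun i => Nat.lt_succ_of_le
    (Finset.single_le_sum (f := ρ) (fun _ _ => Nat.zero_le _) (Finset.mem_univ i))
  exact hQ.pow_row_fin (∑ i, ρ i + 1) m (fun i => ⟨ρ i, h i⟩) κ (fun i j hij => hρ hij) hκ

end IsTP

/-! ### Production matrices and their output matrices. -/

section ProductionMatrix

variable {R : Type*} [CommRing R] {S : Subsemiring R} {P a : Matrix ℕ ℕ R}

/-- Row `n` of `a` is the first row of the `n`-th power of `P`. Truncating to indices at most `N`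
loses nothing up to `n = N + 1`, since the preceding row is supported in columns at most `N`. -/
theorem outputMatrix_eq_pow (h0 : a 0 = Pi.single 0 1)
    (hlow : ∀ n k, n < k → a n k = 0)
    (hsucc : ∀ n k, a (n + 1) k = ∑ i ∈ Finset.range (n + 1), a n i * P i k)
    {N n : ℕ} (hn : n ≤ N + 1) (k : Fin (N + 1)) :
    a n k = ((P.submatrix (Fin.val : Fin (N + 1) → ℕ) Fin.val) ^ n) 0 k := by
  induction n generalizing k with
  | zero =>
    rw [h0, pow_zero, Matrix.one_apply, Pi.single_apply]
    exact if_congr (by rw [Fin.ext_iff, eq_comm]; rfl) rfl rfl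
  | succ n ih =>
    rw [hsucc, pow_succ, Matrix.mul_apply, Finset.sum_subset
      (Finset.range_subset_range.2 hn), Finset.sum_range]
    · exact Finset.sum_congr rfl fun i _ => by rw [ih (by omega)]; rfl
    · intro i _ hi
      rw [hlow n i (by simpa using hi), zero_mul]

/-- The output matrix of a totally positive production matrix is totally positive. -/
theorem IsTP.outputMatrix (hP : IsTP S P) (h0 : a 0 = Pi.single 0 1)
    (hlow : ∀ n k, n < k → a n k = 0)
    (hsucc : ∀ n k, a (n + 1) k = ∑ i ∈ Finset.range (n + 1), a n i * P i k) : IsTP S a := by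
  intro m ρ κ hρ hκ
  have h1 : ∀ i, ρ i ≤ ∑ i, ρ i := fun i =>
    Finset.single_le_sum (f := ρ) (fun _ _ => Nat.zero_le _) (Finset.mem_univ i)
  have h2 : ∀ i, κ i ≤ ∑ i, κ i := fun i =>
    Finset.single_le_sum (f := κ) (fun _ _ => Nat.zero_le _) (Finset.mem_univ i)
  set N := ∑ i, ρ i + ∑ i, κ i with hN
  have hlt : ∀ i, κ i < N + 1 := fun i => by have := h2 i; omega
  convert (hP.submatrix (γ := Fin (N + 1)) (δ := Fin (N + 1)) Fin.val_strictMono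
    Fin.val_strictMono).pow_row m ρ (fun i => ⟨κ i, hlt i⟩) hρ (fun i j hij => hκ hij) using 2
  ext i j
  exact outputMatrix_eq_pow h0 hlow hsucc (by have := h1 i; omega) ⟨κ j, hlt j⟩

/-- The zeroth column of the output matrix of a totally positive production matrix is
Hankel-totally positive. -/
theorem IsTP.hankelMatrix_outputMatrix (hP : IsTP S P) (h0 : a 0 = Pi.single 0 1)
    (hlow : ∀ n k, n < k → a n k = 0)
    (hsucc : ∀ n k, a (n + 1) k = ∑ i ∈ Finset.range (n + 1), a n i * P i k) :
    IsTP S (hankelMatrix fun n => a n 0) := by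
  intro m ρ κ hρ hκ
  have h1 : ∀ i, ρ i ≤ ∑ i, ρ i := fun i =>
    Finset.single_le_sum (f := ρ) (fun _ _ => Nat.zero_le _) (Finset.mem_univ i)
  have h2 : ∀ i, κ i ≤ ∑ i, κ i := fun i =>
    Finset.single_le_sum (f := κ) (fun _ _ => Nat.zero_le _) (Finset.mem_univ i)
  set N := ∑ i, ρ i + ∑ i, κ i with hN
  have hQ := hP.submatrix (γ := Fin (N + 1)) (δ := Fin (N + 1)) Fin.val_strictMono
    Fin.val_strictMono
  -- The entry `(Q^(i+j))₀₀` equals `∑ₖ (Q^i)₀ₖ (Q^j)ₖ₀`: first rows of powers of `Q` times first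
  -- columns, the latter being first rows of powers of the transpose.
  convert (hQ.pow_row.mul hQ.transpose.pow_row.transpose) m ρ κ hρ hκ using 2
  ext i j
  have := outputMatrix_eq_pow h0 hlow hsucc (N := N) (n := ρ i + κ j)
    (by have := h1 i; have := h2 j; omega) 0
  simp only [hankelMatrix, Matrix.submatrix_apply, Matrix.of_apply]
  rw [Fin.val_zero] at this
  rw [this, pow_add, Matrix.mul_apply, Matrix.mul_apply]
  simp only [← Matrix.transpose_pow, Matrix.of_apply, Matrix.transpose_apply]

end ProductionMatrix

namespace IsTP

variable {R : Type*} [CommRing R] {S : Subsemiring R}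

/-- Lower-bidiagonal matrices with nonnegative entries are totally positive. -/
theorem of_bidiagonal {A : Matrix ℕ ℕ R} (hS : ∀ i k, A i k ∈ S)
    (hA : ∀ i k, k ≠ i → k + 1 ≠ i → A i k = 0) : IsTP S A := by
  intro m
  induction m with
  | zero => intros; simp
  | succ m ih =>
    intro ρ κ hρ hκ
    have hmem : A (ρ 0) (κ 0) * (A.submatrix (ρ ∘ Fin.succ) (κ ∘ Fin.succ)).det ∈ S :=
      mul_mem (hS _ _) (ih _ _ (hρ.comp Fin.strictMono_succ) (hκ.comp Fin.strictMono_succ))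
    -- If `κ 0 < ρ 0`, all later rows lie at least two below `κ 0`, so the first column vanishes
    -- below its top entry. Otherwise all later columns lie to the right of the diagonal entry of
    -- row `ρ 0`, so the first row vanishes after its first entry.
    by_cases h : κ 0 < ρ 0
    · rw [Matrix.det_eq_mul_of_column_zero]
      · exact hmem
      · intro i hi
        have := hρ (Fin.pos_of_ne_zero hi)
        exact hA _ _ (by omega) (by omega)
    · rw [Matrix.det_eq_mul_of_row_zero]
      · exact hmem
      · intro j hj
        have := hκ (Fin.pos_of_ne_zero hj)
        exact hA _ _ (by omega) (by omega)

end IsTP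

/-! ### Total positivity of Toeplitz matrices of power series. -/

section Toeplitz

variable {R : Type*} [CommRing R] {S : Subsemiring R}

/-- The infinite lower-triangular Toeplitz matrix of a formal power series. -/
noncomputable def toeplitzMatrix (F : PowerSeries R) : Matrix ℕ ℕ R :=
  Matrix.of fun n k => if k ≤ n then PowerSeries.coeff (n - k) F else 0

theorem toeplitzMatrix_apply (F : PowerSeries R) (n k : ℕ) :
    toeplitzMatrix F n k = if k ≤ n then PowerSeries.coeff (n - k) F else 0 := rfl

theorem toeplitzMatrix_mul (F G : PowerSeries R) {i N : ℕ} (k : ℕ) (hN : i < N) :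
    toeplitzMatrix (F * G) i k =
      ∑ j ∈ Finset.range N, toeplitzMatrix F i j * toeplitzMatrix G j k := by
  simp only [toeplitzMatrix_apply]
  have hsub : Finset.Ico k (i + 1) ⊆ Finset.range N := fun j hj => by
    simp only [Finset.mem_Ico, Finset.mem_range] at hj ⊢
    omega
  rw [← Finset.sum_subset hsub, Finset.sum_Ico_eq_sum_range]
  · split_ifs with hk
    · rw [mul_comm F, PowerSeries.coeff_mul, Finset.Nat.sum_antidiagonal_eq_sum_range_succ_mk,
        show (i - k).succ = i + 1 - k by omega]
      refine Finset.sum_congr rfl fun l hl => ?_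
      rw [Finset.mem_range] at hl
      rw [if_pos (by omega), if_pos (by omega), mul_comm, Nat.add_sub_cancel_left, Nat.sub_sub]
    · rw [show i + 1 - k = 0 by omega, Finset.sum_range_zero]
  · intro j _ hj
    rw [Finset.mem_Ico] at hj
    by_cases h : k ≤ j
    · rw [if_neg (by omega), zero_mul]
    · rw [if_neg h, mul_zero]

theorem isTP_toeplitzMatrix_mul {F G : PowerSeries R} (hF : IsTP S (toeplitzMatrix F))
    (hG : IsTP S (toeplitzMatrix G)) : IsTP S (toeplitzMatrix (F * G)) :=
  hF.mul_nat hG fun _ k _ h => toeplitzMatrix_mul F G k (by omega)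

theorem isTP_toeplitzMatrix_one : IsTP S (toeplitzMatrix (1 : PowerSeries R)) := by
  refine IsTP.of_bidiagonal (fun i k => ?_) fun i k h _ => ?_
  · simp only [toeplitzMatrix_apply, PowerSeries.coeff_one]
    split_ifs
    exacts [one_mem S, zero_mem S, zero_mem S]
  · simp only [toeplitzMatrix_apply, PowerSeries.coeff_one]
    split_ifs
    exacts [by omega, rfl, rfl]

theorem isTP_toeplitzMatrix_prod {ι : Type*} (s : Finset ι) {F : ι → PowerSeries R}
    (hF : ∀ i ∈ s, IsTP S (toeplitzMatrix (F i))) : IsTP S (toeplitzMatrix (∏ i ∈ s, F i)) :=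
  Finset.prod_induction F (fun G => IsTP S (toeplitzMatrix G))
    (fun _ _ => isTP_toeplitzMatrix_mul) isTP_toeplitzMatrix_one hF

theorem isTP_toeplitzMatrix_one_add {x : R} (hx : x ∈ S) :
    IsTP S (toeplitzMatrix (1 + PowerSeries.C x * PowerSeries.X)) := by
  refine IsTP.of_bidiagonal (fun i k => ?_) fun i k h h' => ?_
  · simp only [toeplitzMatrix_apply, map_add, PowerSeries.coeff_one, PowerSeries.coeff_C_mul,
      PowerSeries.coeff_X, mul_ite, mul_one, mul_zero]
    exact ite_mem.2 ⟨fun _ => add_mem (ite_mem.2 ⟨fun _ => one_mem S, fun _ => zero_mem S⟩)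
      (ite_mem.2 ⟨fun _ => hx, fun _ => zero_mem S⟩), fun _ => zero_mem S⟩
  · simp only [toeplitzMatrix_apply, map_add, PowerSeries.coeff_one, PowerSeries.coeff_C_mul,
      PowerSeries.coeff_X]
    by_cases hk : k ≤ i
    · rw [if_pos hk, if_neg (by omega), if_neg (by omega), mul_zero, add_zero]
    · rw [if_neg hk]

/-- If a second chosen column also starts at or above the first chosen row, the first column is a
power of `x` times that column and the minor vanishes. Otherwise the first row has at most its first
entry, and expansion along it gives the induction. -/
theorem isTP_toeplitzMatrix_geometric {x : R} (hx : x ∈ S) :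
    IsTP S (toeplitzMatrix (PowerSeries.mk fun n => x ^ n)) := by
  intro m
  induction m with
  | zero => intros; simp
  | succ m ih =>
    intro ρ κ hρ hκ
    by_cases h : ∃ j, j ≠ 0 ∧ κ j ≤ ρ 0
    · obtain ⟨j, hj, hle⟩ := h
      have hlt := hκ (Fin.pos_of_ne_zero hj)
      rw [← Matrix.det_updateCol_add_smul_self _ hj.symm (-x ^ (κ j - κ 0)),
        Matrix.det_eq_zero_of_column_eq_zero 0]
      · exact zero_mem S
      · intro i
        have := hρ.monotone (Fin.zero_le i)
        simp only [Matrix.updateCol_self, Matrix.submatrix_apply, toeplitzMatrix_apply,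
          PowerSeries.coeff_mk, smul_eq_mul]
        rw [if_pos (by omega), if_pos (by omega), neg_mul, ← pow_add,
          show κ j - κ 0 + (ρ i - κ j) = ρ i - κ 0 by omega, add_neg_cancel]
    · push Not at h
      rw [Matrix.det_eq_mul_of_row_zero]
      · refine mul_mem ?_ (ih _ _ (hρ.comp Fin.strictMono_succ) (hκ.comp Fin.strictMono_succ))
        simp only [Matrix.submatrix_apply, toeplitzMatrix_apply, PowerSeries.coeff_mk]
        exact ite_mem.2 ⟨fun _ => pow_mem hx _, fun _ => zero_mem S⟩
      · intro j hj
        simp only [Matrix.submatrix_apply, toeplitzMatrix_apply, if_neg (h j hj).not_ge]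

end Toeplitz

/-! ### Product formulas for the generating series of symmetric polynomials. -/

section SymmetricFunctions

open MvPolynomial

theorem MvPolynomial.mk_esymm_eq_prod (σ R : Type*) [Fintype σ] [CommRing R] :
    PowerSeries.mk (esymm σ R) =
      ∏ i : σ, (1 + PowerSeries.C (X i : MvPolynomial σ R) * PowerSeries.X) := by
  classical
  rw [Finset.prod_one_add]
  ext1 n
  simp only [PowerSeries.coeff_mk, map_sum, Finset.prod_mul_distrib, Finset.prod_const, ← map_prod,
    PowerSeries.coeff_C_mul_X_pow, esymm]
  rw [← Finset.sum_filter]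
  refine Finset.sum_congr ?_ fun _ _ => rfl
  ext t
  simp [Finset.mem_powersetCard, eq_comm]

theorem MvPolynomial.mk_hsymm_eq_prod (σ R : Type*) [Fintype σ] [DecidableEq σ] [CommRing R] :
    PowerSeries.mk (hsymm σ R) =
      ∏ i : σ, PowerSeries.mk fun n => (X i : MvPolynomial σ R) ^ n := by
  ext1 n
  rw [PowerSeries.coeff_prod]
  simp only [PowerSeries.coeff_mk, hsymm]
  refine Finset.sum_bij' (fun s _ => (Sym.equivNatSum σ n s : σ →₀ ℕ))
    (fun l hl => (Sym.equivNatSum σ n).symm ⟨l, ?_⟩) ?_ ?_ ?_ ?_ ?_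
  · simpa [Finsupp.sum_fintype] using hl
  · intro s _
    have := (Sym.equivNatSum σ n s).2
    rw [Finsupp.sum_fintype _ _ (by simp)] at this
    exact Finset.mem_finsuppAntidiag.2 ⟨this, Finset.subset_univ _⟩
  · simp
  · simp
  · simp
  · intro s _
    rw [Finset.prod_multiset_map_count]
    refine Finset.prod_subset (Finset.subset_univ _) fun i _ hi => ?_
    rw [Multiset.count_eq_zero_of_notMem (by simpa using hi), pow_zero]

end SymmetricFunctions

/-! ### The production matrix of the Lah triangle. -/

section ProductionMatrix

variable {R : Type*} [CommRing R] {S : Subsemiring R}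

/-- The production matrix of the Lah triangle. -/
def lahProduction (φ : ℕ → R) : Matrix ℕ ℕ R :=
  Matrix.of fun i k => if 1 ≤ k ∧ k ≤ i + 1 then
    (i.descFactorial (i + 1 - k) : R) * φ (i + 1 - k) else 0

theorem lahProduction_apply (φ : ℕ → R) (i k : ℕ) :
    lahProduction φ i k = if 1 ≤ k ∧ k ≤ i + 1 then
      (i.descFactorial (i + 1 - k) : R) * φ (i + 1 - k) else 0 := rfl

/-- Without its zeroth column, the production matrix is the Toeplitz matrix of `φ` conjugated by the
diagonal matrix of factorials; the denominators are cleared because `R` need not contain them. -/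
theorem lahProduction_succ_right (φ : ℕ → R) (i k : ℕ) :
    (k.factorial : R) * lahProduction φ i (k + 1) =
      i.factorial * toeplitzMatrix (PowerSeries.mk φ) i k := by
  rw [lahProduction_apply, toeplitzMatrix_apply]
  by_cases h : k ≤ i
  · rw [if_pos (by omega), if_pos h, PowerSeries.coeff_mk, Nat.add_sub_add_right, ← mul_assoc,
      ← Nat.cast_mul]
    have := Nat.factorial_mul_descFactorial (n := i) (k := i - k) (by omega)
    rw [Nat.sub_sub_self h] at this
    rw [this]
  · rw [if_neg (by omega), if_neg h, mul_zero, mul_zero]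

/-- Scaling rows and columns by factorials turns minors into Toeplitz minors; `hS` cancels the
column factorials afterwards. Minors that use column 0 vanish. -/
theorem isTP_lahProduction {φ : ℕ → R} (hS : ∀ (n : ℕ) (x : R), n ≠ 0 → n * x ∈ S → x ∈ S)
    (hφ : IsTP S (toeplitzMatrix (PowerSeries.mk φ))) : IsTP S (lahProduction φ) := by
  intro m ρ κ hρ hκ
  by_cases h0 : ∃ j, κ j = 0
  · obtain ⟨j, hj⟩ := h0
    rw [Matrix.det_eq_zero_of_column_eq_zero j]
    · exact zero_mem S
    · intro i
      simp [hj, lahProduction_apply]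
  · push Not at h0
    have hsucc : ∀ j, κ j - 1 + 1 = κ j := fun j => by have := h0 j; omega
    refine hS (∏ j, (κ j - 1).factorial) _
      (Finset.prod_ne_zero_iff.2 fun j _ => Nat.factorial_ne_zero _) ?_
    have h : (Matrix.of fun i j => ((κ j - 1).factorial : R) *
        (lahProduction φ).submatrix ρ κ i j) =
        Matrix.of fun i j => ((ρ i).factorial : R) *
          (toeplitzMatrix (PowerSeries.mk φ)).submatrix ρ (fun j => κ j - 1) i j := by
      ext i j
      have := lahProduction_succ_right φ (ρ i) (κ j - 1)
      rw [hsucc] at this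
      exact this
    have hdet := congrArg Matrix.det h
    rw [Matrix.det_mul_row, Matrix.det_mul_column, ← Nat.cast_prod, ← Nat.cast_prod] at hdet
    rw [hdet]
    exact mul_mem (natCast_mem S _) (hφ m _ _ hρ fun i j hij => by
      have := hκ hij
      have := h0 i
      change κ i - 1 < κ j - 1
      omega)

end ProductionMatrix

/-! ### Decomposition of forests by their least vertex. -/

section Forests

open Finset

theorem card_nodup_list_subset {α : Type*} [Fintype α] [DecidableEq α] (s : Finset α) (m : ℕ) :
    (univ.filter fun l : {l : List α // l.Nodup} => (∀ w ∈ l.1, w ∈ s) ∧ l.1.length = m).card =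
      s.card.descFactorial m := by
  rw [← Fintype.card_fin m, ← Fintype.card_coe s, ← Fintype.card_embedding_eq, Fintype.card_fin,
    ← Finset.card_univ]
  symm
  refine Finset.card_bij (fun f _ => ⟨List.ofFn fun i => (f i : α), List.nodup_ofFn.2
    (Subtype.val_injective.comp f.injective)⟩) ?_ ?_ ?_
  · intro f _
    simp [List.mem_ofFn]
  · intro f _ g _ h
    ext i
    simp only [Subtype.mk.injEq] at h
    exact congrFun (List.ofFn_injective h) i
  · rintro ⟨l, hl⟩ h
    simp only [mem_filter, mem_univ, true_and] at h
    obtain ⟨h1, rfl⟩ := h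
    refine ⟨⟨fun i => ⟨l.get i, h1 _ (List.get_mem _ _)⟩, fun i j hij => ?_⟩, mem_univ _, ?_⟩
    · exact List.nodup_iff_injective_get.1 hl (by simpa using hij)
    · ext1
      simp

/-- Adding to a forest a new least vertex with a given list of children. -/
def forestCons {n : ℕ} (l : {l : List (Fin n) // l.Nodup})
    (c : Fin n → {l : List (Fin n) // l.Nodup}) :
    Fin (n + 1) → {l : List (Fin (n + 1)) // l.Nodup} :=
  Fin.cons (α := fun _ => {l : List (Fin (n + 1)) // l.Nodup})
    ⟨l.1.map Fin.succ, l.2.map (Fin.succ_injective n)⟩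
    fun v => ⟨(c v).1.map Fin.succ, (c v).2.map (Fin.succ_injective n)⟩

variable {n : ℕ} (l : {l : List (Fin n) // l.Nodup}) (c : Fin n → {l : List (Fin n) // l.Nodup})

@[simp]
theorem forestCons_zero : (forestCons l c 0).1 = l.1.map Fin.succ := rfl

@[simp]
theorem forestCons_succ (v : Fin n) : (forestCons l c v.succ).1 = (c v).1.map Fin.succ := rfl

/-- Parents stay unique exactly when the new vertex adopts only vertices that had no parent; its own
label is below all others. -/
theorem isIncreasingOrderedForest_forestCons :
    IsIncreasingOrderedForest (forestCons l c) ↔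
      IsIncreasingOrderedForest c ∧ ∀ w ∈ l.1, w ∈ forestRoots c := by
  constructor
  · rintro ⟨h1, h2⟩
    refine ⟨⟨fun v w hw => ?_, fun u v w hu hv => ?_⟩, fun w hw => ?_⟩
    · exact Fin.succ_lt_succ_iff.1 (h1 v.succ w.succ (by simpa using hw))
    · exact Fin.succ_injective n (h2 u.succ v.succ w.succ (by simpa using hu) (by simpa using hv))
    · simp only [forestRoots, mem_filter, mem_univ, true_and]
      intro v hv
      exact Fin.succ_ne_zero v (h2 v.succ 0 w.succ (by simpa using hv) (by simpa using hw))
  · rintro ⟨⟨h1, h2⟩, h3⟩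
    simp only [forestRoots, mem_filter, mem_univ, true_and] at h3
    refine ⟨fun v w hw => ?_, fun u v w hu hv => ?_⟩
    · refine Fin.cases (fun hw => ?_) (fun v hw => ?_) v hw
      · rw [forestCons_zero, List.mem_map] at hw
        obtain ⟨x, _, rfl⟩ := hw
        exact Fin.succ_pos x
      · rw [forestCons_succ, List.mem_map] at hw
        obtain ⟨x, hx, rfl⟩ := hw
        exact Fin.succ_lt_succ_iff.2 (h1 v x hx)
    · rcases Fin.eq_zero_or_eq_succ u with rfl | ⟨u, rfl⟩ <;>
        rcases Fin.eq_zero_or_eq_succ v with rfl | ⟨v, rfl⟩ <;>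
        simp only [forestCons_zero, forestCons_succ, List.mem_map] at hu hv <;>
        obtain ⟨x, hx, rfl⟩ := hu <;>
        obtain ⟨y, hy, hxy⟩ := hv <;>
        obtain rfl := Fin.succ_injective n hxy
      · rfl
      · exact absurd hy (h3 _ hx v)
      · exact absurd hx (h3 _ hy u)
      · rw [h2 u v _ hx hy]

theorem card_forestRoots_forestCons (h : ∀ w ∈ l.1, w ∈ forestRoots c) :
    (forestRoots (forestCons l c)).card = (forestRoots c).card - l.1.length + 1 := by
  have : forestRoots (forestCons l c) =
      insert 0 ((forestRoots c \ l.1.toFinset).map (Fin.succEmb n)) := by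
    ext w
    rcases Fin.eq_zero_or_eq_succ w with rfl | ⟨w, rfl⟩
    · simp [forestRoots, Fin.forall_fin_succ]
    · have hw : w.succ ∈ insert 0 ((forestRoots c \ l.1.toFinset).map (Fin.succEmb n)) ↔
          w ∈ forestRoots c \ l.1.toFinset := by
        rw [mem_insert, or_iff_right (Fin.succ_ne_zero w)]
        exact mem_map' (Fin.succEmb n)
      rw [hw]
      simp only [forestRoots, mem_filter, mem_univ, true_and, Fin.forall_fin_succ,
        forestCons_zero, forestCons_succ, List.mem_map_of_injective (Fin.succ_injective n),
        mem_sdiff, List.mem_toFinset, and_comm]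
  rw [this, card_insert_of_notMem (by simp), card_map, card_sdiff_of_subset,
    List.toFinset_card_of_nodup l.2]
  intro w hw
  exact h w (by simpa using hw)

/-- Labels increase from parent to child, so 0 is nobody's child and every child list consists of
successors. -/
theorem exists_forestCons {c : Fin (n + 1) → {l : List (Fin (n + 1)) // l.Nodup}}
    (hc : IsIncreasingOrderedForest c) : ∃ l c', forestCons l c' = c := by
  have h : ∀ v, ∃ l : {l : List (Fin n) // l.Nodup}, l.1.map Fin.succ = (c v).1 := by
    intro v
    have : ∀ w ∈ (c v).1, w ∈ Set.range (Fin.succ : Fin n → Fin (n + 1)) := fun w hw =>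
      Fin.exists_succ_eq.2 ((Fin.zero_le v).trans_lt (hc.1 v w hw)).ne'
    change (c v).1 ∈ {l | ∀ w ∈ l, w ∈ Set.range Fin.succ} at this
    rw [← Set.range_list_map] at this
    obtain ⟨l, hl⟩ := this
    exact ⟨⟨l, List.Nodup.of_map Fin.succ (hl ▸ (c v).2)⟩, hl⟩
  choose f hf using h
  refine ⟨f 0, fun v => f v.succ, funext fun v => Subtype.ext ?_⟩
  rcases Fin.eq_zero_or_eq_succ v with rfl | ⟨v, rfl⟩
  · exact hf 0
  · exact hf v.succ

theorem forestCons_injective {l l' : {l : List (Fin n) // l.Nodup}}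
    {c c' : Fin n → {l : List (Fin n) // l.Nodup}} (h : forestCons l c = forestCons l' c') :
    l = l' ∧ c = c' := by
  have hinj := List.map_injective_iff.2 (Fin.succ_injective n)
  refine ⟨Subtype.ext (hinj ?_), funext fun v => Subtype.ext (hinj ?_)⟩
  · exact congrArg Subtype.val (congrFun h 0)
  · exact congrArg Subtype.val (congrFun h v.succ)

end Forests

/-! ### Recurrences for the row polynomials and the Lah triangle. -/

section Recurrence

open Finset Polynomial

variable {R : Type*} [CommRing R] (φ : ℕ → R)

theorem lahRow_eq_sum_forests (n : ℕ) :
    lahRow φ n = ∑ c : Fin n → {l : List (Fin n) // l.Nodup} with IsIncreasingOrderedForest c,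
      C (∏ v, φ (c v).1.length) * X ^ (forestRoots c).card := by
  rw [← sum_fiberwise_of_maps_to (t := range (n + 1)) (g := fun c => (forestRoots c).card)]
  · rw [lahRow]
    refine sum_congr rfl fun k _ => ?_
    rw [lah, map_sum, sum_mul, increasingOrderedForests, filter_filter]
    refine sum_congr rfl fun c hc => ?_
    rw [(mem_filter.1 hc).2.2]
  · intro c _
    have := card_le_univ (forestRoots c)
    rw [Fintype.card_fin] at this
    exact mem_range_succ_iff.2 this

theorem lahRow_zero : lahRow φ 0 = 1 := by
  rw [lahRow_eq_sum_forests, Finset.filter_true_of_mem]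
  · simp [forestRoots]
  · exact fun c _ => ⟨fun v => v.elim0, fun v => v.elim0⟩

theorem natDegree_lahRow_le (n : ℕ) : (lahRow φ n).natDegree ≤ n :=
  natDegree_sum_le_of_forall_le _ _ fun _ hk =>
    (natDegree_C_mul_X_pow_le _ _).trans (mem_range_succ_iff.1 hk)

theorem coeff_lahRow (n k : ℕ) (hk : k ≤ n) : (lahRow φ n).coeff k = lah φ n k := by
  simp only [lahRow, finsetSum_coeff, coeff_C_mul_X_pow]
  rw [sum_ite_eq, if_pos (mem_range_succ_iff.2 hk)]

/-- Over a forest with `k` roots, the new least vertex can receive `m` ordered children in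
`k(k-1)⋯(k-m+1)` ways, leaving `k - m + 1` roots. In generating functions this sends `X^k` to `X *
m! * hasseDeriv m (X^k)`. -/
theorem lahRow_succ (n : ℕ) :
    lahRow φ (n + 1) =
      X * ∑ m ∈ range (n + 1), C (m.factorial * φ m) * hasseDeriv m (lahRow φ n) := by
  calc lahRow φ (n + 1)
      = ∑ c : Fin n → {l : List (Fin n) // l.Nodup} with IsIncreasingOrderedForest c,
          ∑ l : {l : List (Fin n) // l.Nodup} with ∀ w ∈ l.1, w ∈ forestRoots c,
          C (φ l.1.length * ∏ v, φ (c v).1.length) *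
            X ^ ((forestRoots c).card - l.1.length + 1) := by
        rw [lahRow_eq_sum_forests, sum_sigma']
        symm
        refine sum_bij (fun x _ => forestCons x.2 x.1) ?_ ?_ ?_ ?_
        · rintro ⟨c, l⟩ h
          simpa [isIncreasingOrderedForest_forestCons] using h
        · rintro ⟨c, l⟩ _ ⟨c', l'⟩ _ h
          obtain ⟨rfl, rfl⟩ := forestCons_injective h
          rfl
        · intro c hc
          obtain ⟨l, c', rfl⟩ := exists_forestCons (mem_filter.1 hc).2
          exact ⟨⟨c', l⟩, by simpa [isIncreasingOrderedForest_forestCons] using hc, rfl⟩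
        · rintro ⟨c, l⟩ h
          rw [card_forestRoots_forestCons l c (by simpa using (mem_sigma.1 h).2),
            Fin.prod_univ_succ]
          simp
    _ = ∑ c : Fin n → {l : List (Fin n) // l.Nodup} with IsIncreasingOrderedForest c,
          ∑ m ∈ range (n + 1), C (m.factorial * φ m) * (X * hasseDeriv m
            (C (∏ v, φ (c v).1.length) * X ^ (forestRoots c).card)) := by
        refine sum_congr rfl fun c _ => ?_
        rw [← sum_fiberwise_of_maps_to (t := range (n + 1)) (g := fun l => l.1.length)]
        · refine sum_congr rfl fun m _ => ?_
          rw [filter_filter]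
          rw [sum_congr rfl (g := fun _ => C (φ m * ∏ v, φ (c v).1.length) *
            X ^ ((forestRoots c).card - m + 1))
            fun l hl => by rw [(mem_filter.1 hl).2.2]]
          have hcard := card_nodup_list_subset (forestRoots c) m
          rw [sum_const, show Finset.card _ = (forestRoots c).card.descFactorial m by convert hcard,
            C_mul_X_pow_eq_monomial, C_mul_X_pow_eq_monomial,
            hasseDeriv_monomial,
            Nat.descFactorial_eq_factorial_mul_choose, ← C_mul_X_pow_eq_monomial,
            ← C_mul_X_pow_eq_monomial, nsmul_eq_mul]
          push_cast [map_mul, map_natCast]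
          ring
        · intro l _
          have := l.2.length_le_card
          rw [Fintype.card_fin] at this
          exact mem_range_succ_iff.2 this
    _ = _ := by
        rw [sum_comm, mul_sum]
        refine sum_congr rfl fun m _ => ?_
        rw [lahRow_eq_sum_forests, map_sum, mul_sum, mul_sum]
        exact sum_congr rfl fun c _ => by ring

theorem Polynomial.hasseDeriv_succ_X_mul (k : ℕ) (f : R[X]) :
    hasseDeriv (k + 1) (X * f) = X * hasseDeriv (k + 1) f + hasseDeriv k f := by
  ext n
  rcases n with _ | n
  · simp [hasseDeriv_coeff]
  · rw [coeff_add, coeff_X_mul, hasseDeriv_coeff, hasseDeriv_coeff, hasseDeriv_coeff,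
      show n + 1 + (k + 1) = n + 1 + k + 1 by ring, coeff_X_mul, Nat.choose_succ_succ,
      show n + (k + 1) = n + 1 + k by ring]
    push_cast
    ring

/-- This exhibits a production matrix for the Hasse derivatives of the rows. Composing Hasse
derivatives turns the sum in `lahRow_succ` into column `k + 1` of `lahProduction φ`; the Leibniz
rule for the factor `X` adds column `k`. Evaluation at 0 recovers the recurrence of the Lah
triangle. -/
theorem hasseDeriv_lahRow_succ (n k : ℕ) :
    hasseDeriv k (lahRow φ (n + 1)) = ∑ i ∈ range (n + 1), hasseDeriv i (lahRow φ n) *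
      (C (lahProduction φ i k) + X * C (lahProduction φ i (k + 1))) := by
  have hU : ∀ k, hasseDeriv k
      (∑ m ∈ range (n + 1), C (m.factorial * φ m) * hasseDeriv m (lahRow φ n)) =
        ∑ i ∈ range (n + 1), hasseDeriv i (lahRow φ n) * C (lahProduction φ i (k + 1)) := by
    intro k
    symm
    -- The range becomes `k ≤ i < k + n + 1`, to match `i = k + m`: terms with `i > n` vanish by
    -- degree, those with `i < k` by the shape of `lahProduction`.
    rw [sum_subset (range_subset_range.2 (show n + 1 ≤ k + n + 1 by omega)), 
      ← sum_subset (s₁ := Ico k (k + n + 1)), sum_Ico_eq_sum_range, map_sum, add_assoc,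
      Nat.add_sub_cancel_left]
    · refine sum_congr rfl fun m _ => ?_
      rw [← smul_eq_C_mul (m.factorial * φ m), map_smul, ← LinearMap.comp_apply, hasseDeriv_comp,
        lahProduction_apply, if_pos (by omega), show k + m + 1 - (k + 1) = m by omega,
        Nat.descFactorial_eq_factorial_mul_choose, Nat.choose_symm_add, smul_eq_C_mul,
        LinearMap.smul_apply, nsmul_eq_mul]
      push_cast [map_mul, map_natCast]
      ring
    · intro i hi
      simp only [mem_Ico, mem_range] at hi ⊢
      omega
    · intro i hi hi'
      simp only [mem_Ico, mem_range] at hi hi'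
      rw [lahProduction_apply, if_neg (by omega), map_zero, mul_zero]
    · intro i _ hi
      have := natDegree_lahRow_le φ n
      rw [mem_range] at hi
      rw [hasseDeriv_eq_zero_of_lt_natDegree _ _ (by omega), zero_mul]
  simp only [mul_add, sum_add_distrib, mul_left_comm _ X, ← mul_sum, ← hU]
  rw [lahRow_succ]
  rcases k with _ | k
  · have h0 : ∑ i ∈ range (n + 1), hasseDeriv i (lahRow φ n) * C (lahProduction φ i 0) = 0 :=
      sum_eq_zero fun i _ => by rw [lahProduction_apply, if_neg (by omega), map_zero, mul_zero]
    rw [h0, zero_add, hasseDeriv_zero', hasseDeriv_zero']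
  · rw [hasseDeriv_succ_X_mul, hU k, add_comm]

theorem lah_eq_zero_of_lt {n k : ℕ} (h : n < k) : lah φ n k = 0 := by
  rw [lah, increasingOrderedForests, filter_false_of_mem, sum_empty]
  rintro c _ ⟨_, hc⟩
  have := card_le_univ (forestRoots c)
  rw [Fintype.card_fin] at this
  omega

theorem lah_eq_eval_hasseDeriv (n k : ℕ) : lah φ n k = (hasseDeriv k (lahRow φ n)).eval 0 := by
  rw [← coeff_zero_eq_eval_zero, hasseDeriv_coeff, zero_add, Nat.choose_self, Nat.cast_one,
    one_mul]
  rcases le_or_gt k n with h | h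
  · rw [coeff_lahRow φ n k h]
  · rw [lah_eq_zero_of_lt φ h, coeff_eq_zero_of_natDegree_lt
      ((natDegree_lahRow_le φ n).trans_lt h)]

theorem lah_zero_left (k : ℕ) : lah φ 0 k = if k = 0 then 1 else 0 := by
  rw [lah_eq_eval_hasseDeriv, lahRow_zero]
  split_ifs with h
  · rw [h, hasseDeriv_zero', eval_one]
  · rw [hasseDeriv_apply_one _ (Nat.pos_of_ne_zero h), eval_zero]

theorem lah_succ_left (n k : ℕ) :
    lah φ (n + 1) k = ∑ i ∈ range (n + 1), lah φ n i * lahProduction φ i k := by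
  simp only [lah_eq_eval_hasseDeriv]
  rw [hasseDeriv_lahRow_succ, eval_finsetSum]
  simp

theorem lah_succ_zero (n : ℕ) : lah φ (n + 1) 0 = 0 := by
  rw [lah_succ_left, sum_eq_zero]
  intro i _
  rw [lahProduction_apply, if_neg (by omega), mul_zero]

theorem lah_self (h : φ 0 = 1) (n : ℕ) : lah φ n n = 1 := by
  induction n with
  | zero => rw [lah_zero_left, if_pos rfl]
  | succ n ih =>
    rw [lah_succ_left, sum_range_succ, ih, sum_eq_zero, lahProduction_apply,
      if_pos (by omega), Nat.sub_self, h]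
    · simp
    · intro i hi
      rw [mem_range] at hi
      rw [lahProduction_apply, if_neg (by omega), mul_zero]

end Recurrence

/-! ### Transfer of total positivity from the production matrix. -/

section LahTotalPositivity

open Finset Polynomial

variable {R : Type*} [CommRing R] {S : Subsemiring R} {φ : ℕ → R}

theorem isTP_lahTriangle (hP : IsTP S (lahProduction φ)) : IsTP S (lahTriangle φ) := by
  refine hP.outputMatrix (funext fun k => ?_) (fun n k h => lah_eq_zero_of_lt φ h)
    (lah_succ_left φ)
  rw [Pi.single_apply]
  exact lah_zero_left φ k

/-- Below row 0, column 0 of the Lah triangle vanishes. Deleting row and column 0 therefore leaves a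
triangle produced by the correspondingly shortened matrix, and `φ 0 = 1` normalizes its first row.
-/
theorem IsTP.hankelMatrix_lah_one (hP : IsTP S (lahProduction φ)) (h0 : φ 0 = 1) :
    IsTP S (hankelMatrix fun n => lah φ (n + 1) 1) := by
  have hsucc : StrictMono Nat.succ := fun _ _ => Nat.succ_lt_succ
  refine (hP.submatrix hsucc hsucc).hankelMatrix_outputMatrix
    (a := Matrix.of fun n k => lah φ (n + 1) (k + 1)) (funext fun k => ?_)
    (fun n k h => lah_eq_zero_of_lt φ (Nat.succ_lt_succ h)) fun n k => ?_
  · rw [Pi.single_apply, Matrix.of_apply]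
    split_ifs with h
    · rw [h, lah_self φ h0]
    · exact lah_eq_zero_of_lt φ (by omega)
  · simp only [Matrix.of_apply, Matrix.submatrix_apply]
    rw [lah_succ_left, sum_range_succ', lah_succ_zero, zero_mul, add_zero]

/-- The rows form column 0 of the matrix of their Hasse derivatives. Its production matrix is
`lahProduction φ` times the bidiagonal matrix with 1 on the diagonal and `X` just below it. -/
theorem IsTP.hankelMatrix_lahRow {S' : Subsemiring R[X]} (hP : IsTP S (lahProduction φ))
    (hC : ∀ x ∈ S, C x ∈ S') (hX : X ∈ S') : IsTP S' (hankelMatrix fun n => lahRow φ n) := by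
  have hB : IsTP S' (Matrix.of fun i k : ℕ =>
      (if i = k then 1 else 0) + (if i = k + 1 then X else 0)) := by
    refine IsTP.of_bidiagonal (fun i k => ?_) fun i k h h' => ?_
    · exact add_mem (ite_mem.2 ⟨fun _ => one_mem S', fun _ => zero_mem S'⟩)
        (ite_mem.2 ⟨fun _ => hX, fun _ => zero_mem S'⟩)
    · rw [Matrix.of_apply, if_neg h.symm, if_neg (Ne.symm h'), add_zero]
  have hQ : IsTP S' (Matrix.of fun i k =>
      C (lahProduction φ i k) + X * C (lahProduction φ i (k + 1))) := by
    refine (hP.map C hC).mul_nat hB fun i k N hN => ?_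
    have hz : ∀ j, i + 1 < j → lahProduction φ i j = 0 := fun j hj => by
      rw [lahProduction_apply, if_neg (by omega)]
    -- The added terms are zero; the longer range is certain to contain `k` and `k + 1`.
    rw [sum_subset (range_subset_range.2 (show N ≤ N + (k + 2) by omega))]
    · simp only [Matrix.of_apply, Matrix.map_apply, mul_add, mul_ite, mul_one, mul_zero,
        sum_add_distrib, sum_ite_eq', mem_range]
      rw [if_pos (by omega), if_pos (by omega), mul_comm X]
    · intro j _ hj
      rw [mem_range, not_lt] at hj
      rw [Matrix.map_apply, hz j (by omega), map_zero, zero_mul]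
  have h := hQ.hankelMatrix_outputMatrix (a := Matrix.of fun n k => hasseDeriv k (lahRow φ n))
    (funext fun k => ?_) (fun n k h => ?_) (fun n k => hasseDeriv_lahRow_succ φ n k)
  · simpa only [Matrix.of_apply, hasseDeriv_zero'] using h
  · rw [Pi.single_apply, Matrix.of_apply, lahRow_zero]
    split_ifs with h
    · rw [h, hasseDeriv_zero']
    · exact hasseDeriv_apply_one _ (Nat.pos_of_ne_zero h)
  · exact hasseDeriv_eq_zero_of_lt_natDegree _ _ ((natDegree_lahRow_le φ n).trans_lt h)

end LahTotalPositivity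

/-! ### Polynomials with nonnegative coefficients and the conclusion. -/

section Coefficientwise

/-- The polynomials with nonnegative coefficients form a subsemiring. -/
def coeffNonnegSubsemiring (r : ℕ) : Subsemiring (MvPolynomial (Fin r) ℤ) where
  carrier := coeffNonneg r
  zero_mem' d := by simp
  one_mem' d := by
    rw [MvPolynomial.coeff_one]
    split_ifs <;> simp
  add_mem' ha hb d := by
    rw [MvPolynomial.coeff_add]
    exact add_nonneg (ha d) (hb d)
  mul_mem' ha hb d := by
    rw [MvPolynomial.coeff_mul]
    exact Finset.sum_nonneg fun x _ => mul_nonneg (ha _) (hb _)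

/-- The polynomials in `y` whose coefficients have nonnegative coefficients form a subsemiring. -/
def coeffNonnegYSubsemiring (r : ℕ) : Subsemiring (Polynomial (MvPolynomial (Fin r) ℤ)) where
  carrier := coeffNonnegY r
  zero_mem' k d := by simp
  one_mem' k := by
    rw [Polynomial.coeff_one]
    exact ite_mem.2 ⟨fun _ => one_mem (coeffNonnegSubsemiring r),
      fun _ => zero_mem (coeffNonnegSubsemiring r)⟩
  add_mem' ha hb k := by
    rw [Polynomial.coeff_add]
    exact (coeffNonnegSubsemiring r).add_mem (ha k) (hb k)
  mul_mem' ha hb k := by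
    rw [Polynomial.coeff_mul]
    exact (coeffNonnegSubsemiring r).sum_mem fun x _ =>
      (coeffNonnegSubsemiring r).mul_mem (ha _) (hb _)

variable {r : ℕ}

theorem X_mem_coeffNonneg (i : Fin r) : MvPolynomial.X i ∈ coeffNonnegSubsemiring r := fun d => by
  rw [MvPolynomial.coeff_X]
  split_ifs <;> simp

theorem mem_coeffNonneg_of_natCast_mul_mem (n : ℕ) (p : MvPolynomial (Fin r) ℤ) (hn : n ≠ 0)
    (h : n * p ∈ coeffNonnegSubsemiring r) : p ∈ coeffNonnegSubsemiring r := fun d => by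
  have := h d
  rw [← map_natCast MvPolynomial.C, MvPolynomial.coeff_C_mul] at this
  exact nonneg_of_mul_nonneg_right this (by positivity)

theorem C_mem_coeffNonnegY (p : MvPolynomial (Fin r) ℤ) (hp : p ∈ coeffNonnegSubsemiring r) :
    Polynomial.C p ∈ coeffNonnegYSubsemiring r := fun k => by
  rw [Polynomial.coeff_C]
  exact ite_mem.2 ⟨fun _ => hp, fun _ => zero_mem (coeffNonnegSubsemiring r)⟩

theorem X_mem_coeffNonnegY : Polynomial.X ∈ coeffNonnegYSubsemiring r := fun k => by
  rw [Polynomial.coeff_X]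
  exact ite_mem.2 ⟨fun _ => one_mem (coeffNonnegSubsemiring r),
    fun _ => zero_mem (coeffNonnegSubsemiring r)⟩

theorem isTP_toeplitzMatrix_eSeq (r : ℕ) :
    IsTP (coeffNonnegSubsemiring r) (toeplitzMatrix (PowerSeries.mk (eSeq r))) := by
  have h := MvPolynomial.mk_esymm_eq_prod (Fin r) ℤ
  rw [show PowerSeries.mk (eSeq r) = _ from h]
  exact isTP_toeplitzMatrix_prod _ fun i _ => isTP_toeplitzMatrix_one_add (X_mem_coeffNonneg i)

theorem isTP_toeplitzMatrix_hSeq (r : ℕ) :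
    IsTP (coeffNonnegSubsemiring r) (toeplitzMatrix (PowerSeries.mk (hSeq r))) := by
  have h := MvPolynomial.mk_hsymm_eq_prod (Fin r) ℤ
  rw [show PowerSeries.mk (hSeq r) = _ from h]
  exact isTP_toeplitzMatrix_prod _ fun i _ => isTP_toeplitzMatrix_geometric (X_mem_coeffNonneg i)

end Coefficientwise

theorem corollary1p3 (r : ℕ) (hr : 1 ≤ r) (φ : ℕ → MvPolynomial (Fin r) ℤ)
    (hφ : φ = eSeq r ∨ φ = hSeq r) :
    ((∀ n, lahTriangle φ n n = 1) ∧ (∀ n k, n < k → lahTriangle φ n k = 0) ∧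
      IsTotallyPositive (coeffNonneg r) (lahTriangle φ)) ∧
    IsHankelTotallyPositive (coeffNonnegY r) (fun n => lahRow φ n) ∧
    IsHankelTotallyPositive (coeffNonneg r) (fun n => lah φ (n + 1) 1) := by
  have h0 : φ 0 = 1 := by
    rcases hφ with rfl | rfl
    · exact MvPolynomial.esymm_zero _ _
    · exact MvPolynomial.hsymm_zero _ _
  have hT : IsTP (coeffNonnegSubsemiring r) (toeplitzMatrix (PowerSeries.mk φ)) := by
    rcases hφ with rfl | rfl
    · exact isTP_toeplitzMatrix_eSeq r
    · exact isTP_toeplitzMatrix_hSeq r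
  have hP := isTP_lahProduction mem_coeffNonneg_of_natCast_mul_mem hT
  exact ⟨⟨lah_self φ h0, fun n k h => lah_eq_zero_of_lt φ h, isTP_lahTriangle hP⟩,
    hP.hankelMatrix_lahRow C_mem_coeffNonnegY X_mem_coeffNonnegY, hP.hankelMatrix_lah_one h0⟩
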